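/- **Conventions.** A frame $L$ is a complete lattice in which finite meets distribute over arbitrary joins; $\neg a$ is the pseudo-complement of $a$, and $a\prec b$ means $b\vee\neg a=1$. $L$ is a *compact regular frame* if $1=\bigvee B$ implies $1=\bigvee B'$ for some finite $B'\subseteq B$, and $a=\bigvee\{b\mid b\prec a\}$ for every $a\in L$. $\mathbf{KRFrm}$ is the category of compact regular frames and maps preserving finite meets and arbitrary joins. For a topological space $X$, write $x\le y$ if every open set containing $x$ contains $y$; for $U\subseteq X$ let ${\downarrow}U=\{x\mid \exists y\in U,\ x\le y\}$, $\Box U=\{x\mid \forall y\ge x,\ y\in U\}$ and $U^{\bot}=X\setminus\overline U$. $U$ is *regular open* ($U\in\mathsf{RO}(X)$) if $U^{\bot\bot}=U$, and *order-regular open* if $\Box{\downarrow}U=U$; $B$ is *regular closed* if it is the closure of its interior. For $U,V\in\mathsf{RO}(X)$ put $U\ll V$ iff $\overline U\subseteq{\downarrow}V$. For a proper filter $F$ of the Boolean algebra $\mathsf{RO}(X)$ let $F^{\circ}=\{V\in F\mid \exists U\in F,\ U\ll V\}$; $F$ is *concordant* if $F^{\circ}=F$. $X$ is a *$dV$-space*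 if: 1. $X$ is $T_0$, compact and order-normal, i.e. whenever $A$ is closed, $B$ is regular closed and $A\cap\Box B=\emptyset$, there are disjoint open sets $U,V$ with $A\subseteq{\downarrow}U$ and $\Box B\subseteq V$; 2. $\mathsf{RO}(X)$ is a basis of the topology, and every regular open set is order-regular open; 3. for every $x\in X$, $\mathsf{RO}(x)=\{U\in\mathsf{RO}(X)\mid x\in U\}$ is a concordant filter, and for every proper filter $F$ on $\mathsf{RO}(X)$ there is $x\in X$ with $F^{\circ}=\mathsf{RO}(x)$. A *$dV$-map* $f:X\to Y$ between $dV$-spaces is a continuous map such that whenever $f(x)\le y$ there is $x'\ge x$ with $y\le f(x')$. $\mathbf{dVS}$ is the category of $dV$-spaces and $dV$-maps. An open set $U$ is *well-rounded* if for every closed $B\subseteq{\downarrow}U$ there are disjoint open $V,W$ with $B\subseteq{\downarrow}V$ and $X\setminus W\subseteq{\downarrow}U$. Let $\mathcal W(X)$ be the set of well-rounded order-regular open subsets of $X$, ordered by inclusion. For a compact regular frame $L$ let $\Xi(L)$ be the set $L\setminus\{1\}$ with the topology generated by the sets $\{b\mid \neg a\prec b\}$, $a\in L$. **Theorem.** -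 For every compact regular frame $L$, $\Xi(L)$ is a $dV$-space, and $L$ is isomorphic to $\mathcal W(\Xi(L))$. - For every $dV$-space $X$, $\mathcal W(X)$ is a compact regular frame, and $X$ is homeomorphic to $\Xi(\mathcal W(X))$. - Every $dV$-map $f:X\to Y$ induces a frame homomorphism $\mathcal W(f):\mathcal W(Y)\to\mathcal W(X)$, $U\mapsto f^{-1}[U]$, and every frame homomorphism $h:L\to M$ between compact regular frames induces a $dV$-map $\Xi(h):\Xi(M)\to\Xi(L)$, $b\mapsto\bigvee\{a\in L\mid h(a)\le b\}$. The resulting contravariant functors $\mathcal W:\mathbf{dVS}\to\mathbf{KRFrm}$ and $\Xi:\mathbf{KRFrm}\to\mathbf{dVS}$ form a dual equivalence of categories. -/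

import Mathlib

universe u

namespace DeVries

open CategoryTheory

section Topology

variable {X : Type u} [TopologicalSpace X]

/-- The specialization preorder: `x ≤ y` iff every open set containing `x` contains `y`. -/
def SpecLE (x y : X) : Prop := ∀ U : Set X, IsOpen U → x ∈ U → y ∈ U

/-- `↓U`, the closure of `U` in the topology of all sets that are upward closed in the
specialization preorder, i.e. the downward closure of `U`. -/
def down (U : Set X) : Set X := {x | ∃ y ∈ U, SpecLE x y}

/-- The interior of `U` in the topology of all sets that are upward closed in the
specialization preorder. -/
def upInterior (U : Set X) : Set X := {x | ∀ y, SpecLE x y → y ∈ U}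

/-- `U⊥`, the complement of the closure of `U`. -/
def perp (U : Set X) : Set X := (closure U)ᶜ

/-- Membership in `RO(X)`: `U⊥⊥ = U`. -/
def IsRegularOpen (U : Set X) : Prop := perp (perp U) = U

/-- Regular closed sets: closures of their interior. -/
def IsRegularClosed (B : Set X) : Prop := closure (interior B) = B

/-- Regular open sets of the topology of upward closed sets. -/
def IsOrderRegularOpen (U : Set X) : Prop := upInterior (down U) = U

/-- `U ≪ V` iff the closure of `U` is contained in `↓V`. -/
def WayInside (U V : Set X) : Prop := closure U ⊆ down V

/-- An open set `U` is well-rounded if for every closed `B ⊆ ↓U` there are disjoint open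
`V`, `W` with `B ⊆ ↓V` and `-W ⊆ ↓U`. -/
structure IsWellRounded (U : Set X) : Prop where
  isOpen : IsOpen U
  separation : ∀ B : Set X, IsClosed B → B ⊆ down U →
    ∃ V W : Set X, IsOpen V ∧ IsOpen W ∧ Disjoint V W ∧ B ⊆ down V ∧ Wᶜ ⊆ down U

/-- (Proper) filters on the Boolean algebra `RO(X)`, whose order is inclusion, whose binary meet
is intersection, whose top is `X` and whose bottom is `∅`. -/
structure IsROFilter (F : Set (Set X)) : Prop where
  regular : ∀ U ∈ F, IsRegularOpen U
  univ_mem : Set.univ ∈ F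
  inter_mem : ∀ U ∈ F, ∀ V ∈ F, U ∩ V ∈ F
  mem_of_subset : ∀ U ∈ F, ∀ V, IsRegularOpen V → U ⊆ V → V ∈ F
  empty_notMem : ∅ ∉ F

/-- The round part of a family `F` of sets: those `V ∈ F` such that `U ≪ V` for some `U ∈ F`. -/
def roundPart (F : Set (Set X)) : Set (Set X) := {V ∈ F | ∃ U ∈ F, WayInside U V}

/-- Concordant filters on `(RO(X), ≪)`. -/
structure IsConcordant (F : Set (Set X)) : Prop where
  isROFilter : IsROFilter F
  roundPart_eq : roundPart F = F

/-- `RO(x)`, the set of regular open sets that contain `x`. -/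
def regularNhds (x : X) : Set (Set X) := {U | IsRegularOpen U ∧ x ∈ U}

variable (X) in
/-- Order-normal spaces. -/
def IsOrderNormal : Prop :=
  ∀ A B : Set X, IsClosed A → IsRegularClosed B → Disjoint A (upInterior B) →
    ∃ U V : Set X, IsOpen U ∧ IsOpen V ∧ Disjoint U V ∧ A ⊆ down U ∧ upInterior B ⊆ V

variable (X) in
/-- De Vries spaces (`dV`-spaces). -/
structure IsDVSpace : Prop where
  t0 : T0Space X
  compact : CompactSpace X
  orderNormal : IsOrderNormal X
  basis : TopologicalSpace.IsTopologicalBasis {U : Set X | IsRegularOpen U}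
  orderRegular : ∀ U : Set X, IsRegularOpen U → IsOrderRegularOpen U
  concordant : ∀ x : X, IsConcordant (regularNhds x)
  exists_point : ∀ F : Set (Set X), IsROFilter F → ∃ x : X, roundPart F = regularNhds x

/-- `dV`-maps: continuous weakly dense maps. -/
structure IsDVMap {Y : Type u} [TopologicalSpace Y] (f : X → Y) : Prop where
  continuous : Continuous f
  weaklyDense : ∀ (x : X) (y : Y), SpecLE (f x) y → ∃ x' : X, SpecLE x x' ∧ SpecLE y (f x')

variable (X) in
/-- The poset, under inclusion, of well-rounded (open) sets that are order-regular open. -/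
abbrev WORO : Type u := {U : Set X // IsWellRounded U ∧ IsOrderRegularOpen U}

end Topology

section Maps

variable {X Y Z : Type u} [TopologicalSpace X] [TopologicalSpace Y] [TopologicalSpace Z]

theorem SpecLE.map {x y : X} (h : SpecLE x y) {f : X → Y} (hf : Continuous f) :
    SpecLE (f x) (f y) := fun U hU hx => h (f ⁻¹' U) (hU.preimage hf) hx

theorem IsDVMap.id : IsDVMap (id : X → X) :=
  ⟨continuous_id, fun _ y h => ⟨y, h, fun _ _ hy => hy⟩⟩

theorem IsDVMap.comp {g : Y → Z} {f : X → Y} (hg : IsDVMap g) (hf : IsDVMap f) :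
    IsDVMap (g ∘ f) where
  continuous := hg.continuous.comp hf.continuous
  weaklyDense x z h := by
    obtain ⟨y, hy, hz⟩ := hg.weaklyDense (f x) z h
    obtain ⟨x', hx, hy'⟩ := hf.weaklyDense x y hy
    exact ⟨x', hx, fun U hU hzU => (hy'.map hg.continuous) U hU (hz U hU hzU)⟩

end Maps

/-- A `dV`-space, bundled. -/
structure DVS : Type (u + 1) where
  carrier : Type u
  [top : TopologicalSpace carrier]
  isDVSpace : IsDVSpace carrier

instance : CoeSort DVS.{u} (Type u) := ⟨DVS.carrier⟩

attribute [instance] DVS.top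

/-- A morphism of `dV`-spaces is a `dV`-map. -/
@[ext]
structure DVS.Hom (X Y : DVS.{u}) : Type u where
  toFun : X → Y
  isDVMap : IsDVMap toFun

/-- The category of `dV`-spaces and `dV`-maps. -/
instance : Category DVS.{u} where
  Hom := DVS.Hom
  id X := ⟨id, IsDVMap.id⟩
  comp f g := ⟨g.toFun ∘ f.toFun, g.isDVMap.comp f.isDVMap⟩

section Frames

variable {L : Type u} [Order.Frame L]

/-- `a ≺ b` (`a` is rather below `b`): `b ∨ ¬a = 1`, where `¬a` is the pseudo-complement. -/
def RatherBelow (a b : L) : Prop := b ⊔ aᶜ = ⊤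

variable (L) in
/-- Compact regular frames. -/
structure IsCompactRegular : Prop where
  compact : ∀ S : Set L, sSup S = ⊤ → ∃ T : Finset L, (T : Set L) ⊆ S ∧ sSup (T : Set L) = ⊤
  regular : ∀ a : L, a = sSup {b | RatherBelow b a}

variable (L) in
/-- The set of points of `Ξ(L)`: all elements of `L` other than the top. -/
def Xi : Type u := {b : L // b ≠ ⊤}

/-- The topology of `Ξ(L)`, generated by the sets `{b | ¬a ≺ b}` for `a ∈ L`. -/
instance : TopologicalSpace (Xi L) :=
  TopologicalSpace.generateFrom {S | ∃ a : L, S = {b : Xi L | RatherBelow aᶜ b.1}}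

/-- The right adjoint of a frame homomorphism `h : L → M`, sending `b` to the largest `a` such
that `h a ≤ b`. -/
def rightAdjoint {M : Type u} [Order.Frame M] (h : FrameHom L M) (b : M) : L :=
  sSup {a | h a ≤ b}

theorem gc_rightAdjoint {M : Type u} [Order.Frame M] (h : FrameHom L M) :
    GaloisConnection h (rightAdjoint h) := by
  intro a b
  refine ⟨fun hab => le_sSup hab, fun hab => ?_⟩
  refine le_trans (OrderHomClass.mono h hab) ?_
  rw [rightAdjoint, map_sSup]
  exact sSup_le (by rintro _ ⟨c, hc, rfl⟩; exact hc)

/-- The action of `Ξ` on a frame homomorphism `h : L → M`: the right adjoint of `h`, restricted to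
a map `Ξ(M) → Ξ(L)`. -/
def Xi.map {M : Type u} [Order.Frame M] (h : FrameHom L M) (b : Xi M) : Xi L :=
  ⟨rightAdjoint h b.1, fun hb => b.2 (top_le_iff.mp
    ((map_top h).symm.le.trans ((gc_rightAdjoint h ⊤ b.1).mpr hb.ge)))⟩

end Frames

/-- The category of compact regular frames and frame homomorphisms. -/
abbrev KRFrm : Type (u + 1) :=
  ObjectProperty.FullSubcategory (fun L : Frm.{u} => IsCompactRegular L)

/-- The frame homomorphism underlying a morphism of `KRFrm`. -/
abbrev KRFrm.frameHom {L M : KRFrm.{u}} (h : L ⟶ M) : FrameHom L.obj M.obj := h.hom.hom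

/-- A partially ordered set is a compact regular frame if its order is that of a compact regular
frame (the other frame operations are then uniquely determined). -/
def IsCompactRegularFrameOrder (P : Type u) [PartialOrder P] : Prop :=
  ∃ F : Order.Frame P, (∀ a b : P, F.le a b ↔ a ≤ b) ∧ @IsCompactRegular P F

/-- The frame structure of a poset which is a compact regular frame, with the given order. -/
noncomputable abbrev IsCompactRegularFrameOrder.frame {P : Type u} [PartialOrder P]
    (h : IsCompactRegularFrameOrder P) : Order.Frame P :=
  @Frame.copy P h.choose (fun a b : P => a ≤ b)
    (funext fun a => funext fun b => propext (h.choose_spec.1 a b).symm)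
    _ rfl _ rfl _ rfl _ rfl _ rfl _ rfl _ rfl _ rfl

theorem IsCompactRegularFrameOrder.isCompactRegular {P : Type u} [PartialOrder P]
    (h : IsCompactRegularFrameOrder P) : @IsCompactRegular P h.frame := by
  have key : ∀ (F : Order.Frame P) (le : P → P → Prop) (e : le = F.le), @IsCompactRegular P F →
      @IsCompactRegular P (@Frame.copy P F le e
        _ rfl _ rfl _ rfl _ rfl _ rfl _ rfl _ rfl _ rfl) := by
    intro F le e hF
    subst e
    exact @IsCompactRegular.mk P (_) hF.compact hF.regular
  exact key _ _ _ h.choose_spec.2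

/-- The claim that `Ξ` lifts to a contravariant functor from compact regular frames to
`dV`-spaces: `Ξ(L)` is a `dV`-space and `Ξ(h)` is a `dV`-map. -/
structure XiLifts : Prop where
  obj : ∀ L : KRFrm.{u}, IsDVSpace (Xi L.obj)
  map : ∀ {L M : KRFrm.{u}} (h : L ⟶ M), IsDVMap (Xi.map (KRFrm.frameHom h))

/-- The contravariant functor `Ξ`. -/
def xiFunctor (hΞ : XiLifts.{u}) : KRFrm.{u}ᵒᵖ ⥤ DVS.{u} where
  obj L := { carrier := Xi L.unop.obj, isDVSpace := hΞ.obj L.unop }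
  map h := { toFun := Xi.map (KRFrm.frameHom h.unop), isDVMap := hΞ.map h.unop }
  map_id L := by
    apply DVS.Hom.ext
    funext b
    apply Subtype.ext
    exact sSup_eq_of_forall_le_of_forall_lt_exists_gt (fun _ h => h) (fun w h => ⟨_, le_rfl, h⟩)
  map_comp {L M N} h k := by
    apply DVS.Hom.ext
    funext b
    apply Subtype.ext
    exact (gc_rightAdjoint (KRFrm.frameHom (k.unop ≫ h.unop))).u_unique
      ((gc_rightAdjoint (KRFrm.frameHom k.unop)).compose
        (gc_rightAdjoint (KRFrm.frameHom h.unop))) (fun _ => rfl)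

/-- The compact regular frame of well-rounded order-regular open sets of a `dV`-space, given that
this poset is a compact regular frame. -/
noncomputable def woroFrame (h : ∀ X : DVS.{u}, IsCompactRegularFrameOrder (WORO X))
    (X : DVS.{u}) : KRFrm.{u} :=
  ⟨@Frm.of (WORO X) (h X).frame, (h X).isCompactRegular⟩

/-- The claim that the poset of well-rounded order-regular open sets lifts to a contravariant
functor from `dV`-spaces to compact regular frames: this poset is a compact regular frame for every
`dV`-space, and inverse image under a `dV`-map restricts to a frame homomorphism. -/
structure WOROLifts : Prop where
  obj : ∀ X : DVS.{u}, IsCompactRegularFrameOrder (WORO X)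
  map : ∀ {X Y : DVS.{u}} (f : X ⟶ Y), ∃ φ : woroFrame obj Y ⟶ woroFrame obj X,
    ∀ U : WORO Y, (KRFrm.frameHom φ U : WORO X).1 = f.toFun ⁻¹' U.1

/-- The contravariant functor sending a `dV`-space to its frame of well-rounded order-regular open
sets and a `dV`-map to inverse image. -/
noncomputable def woroFunctor (hW : WOROLifts.{u}) : DVS.{u}ᵒᵖ ⥤ KRFrm.{u} where
  obj X := woroFrame hW.obj X.unop
  map f := (hW.map f.unop).choose
  map_id X := by
    apply ObjectProperty.hom_ext
    apply Frm.ext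
    intro U
    exact Subtype.ext ((hW.map (𝟙 X.unop)).choose_spec U)
  map_comp {X Y Z} f g := by
    apply ObjectProperty.hom_ext
    apply Frm.ext
    intro U
    apply Subtype.ext
    refine ((hW.map (g.unop ≫ f.unop)).choose_spec U).trans ?_
    refine Eq.trans ?_ ((hW.map g.unop).choose_spec _).symm
    exact congrArg (fun S => g.unop.toFun ⁻¹' S) ((hW.map f.unop).choose_spec U).symm

end DeVries

/-!
The frame `L` is recovered from `Ξ(L)` through the sets `cobasic a = {b | a ∨ b = 1}`, which form a
basis by compactness and regularity. Their downward closures are the sets `hit a = {b | a ≰ b}`, and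
every open set has a downward closure of this form. Hence `a ↦ cobasic a` identifies `L` with the
order-regular open sets, all of which are well-rounded; it identifies the regular elements `¬¬a = a`
of `L` with the regular open sets, and `≺` with `≪`. The frame homomorphism behind a `dV`-map
`g : Ξ(M) → Ξ(L)` is read off `g ⁻¹' cobasic a`; since `hit` turns joins into unions, it preserves
joins.

Conversely, let `X` be a `dV`-space. The ideals of `RO(X)` that are round for `≪` form a compact
regular frame, and `x ↦ {U | x ∈ U⊥}` is a homeomorphism from `X` onto `Ξ` of it: passing to
complements turns the filters `RO(x)`, hence all round proper filters, into the round proper ideals.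
So `Ξ` is fully faithful and essentially surjective, and `𝒲` is an inverse, being one on the objects
`Ξ(L)`.
-/

namespace DeVries

open CategoryTheory TopologicalSpace Topology

section Frames

theorem exists_codisjoint_of_directedOn {L : Type*} [CompleteLattice L]
    (hL : IsCompactElement (⊤ : L)) {S : Set L} {b : L} (hne : S.Nonempty)
    (hS : DirectedOn (· ≤ ·) S) (h : Codisjoint (sSup S) b) : ∃ c ∈ S, Codisjoint c b := by
  have hSb : DirectedOn (· ≤ ·) ((· ⊔ b) '' S) :=
    hS.mono_comp fun _ _ hxy => sup_le_sup_right hxy b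
  have hsSup : ⊤ ≤ sSup ((· ⊔ b) '' S) := by
    refine h.top_le.trans (sup_le (sSup_le fun x hx => ?_) ?_)
    · exact le_sup_left.trans (le_sSup (Set.mem_image_of_mem _ hx))
    · obtain ⟨s, hs⟩ := hne
      exact le_sup_right.trans (le_sSup (Set.mem_image_of_mem _ hs))
  obtain ⟨_, ⟨c, hc, rfl⟩, hcb⟩ :=
    (CompleteLattice.isCompactElement_iff_le_of_directed_sSup_le _ _).mp hL _ (hne.image _) hSb
      hsSup
  exact ⟨c, hc, codisjoint_iff_le_sup.mpr hcb⟩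

variable {L : Type u} [Order.Frame L] {a b c : L}

theorem ratherBelow_iff_codisjoint : RatherBelow a b ↔ Codisjoint aᶜ b := by
  rw [codisjoint_comm, codisjoint_iff, RatherBelow]

theorem RatherBelow.le (h : RatherBelow a b) : a ≤ b := by
  have : a ⊓ (b ⊔ aᶜ) = a := by rw [h, inf_top_eq]
  rwa [inf_sup_left, inf_compl_self, sup_bot_eq, inf_eq_left] at this

theorem RatherBelow.trans_le (h : RatherBelow a b) (hbc : b ≤ c) : RatherBelow a c :=
  ratherBelow_iff_codisjoint.mpr ((ratherBelow_iff_codisjoint.mp h).mono_right hbc)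

theorem ratherBelow_bot (b : L) : RatherBelow ⊥ b := by
  rw [RatherBelow, compl_bot, sup_top_eq]

theorem RatherBelow.sup (ha : RatherBelow a c) (hb : RatherBelow b c) : RatherBelow (a ⊔ b) c := by
  rw [RatherBelow, compl_sup, sup_inf_left, ha, hb, inf_top_eq]

theorem RatherBelow.compl_compl (h : RatherBelow a b) : RatherBelow aᶜᶜ b := by
  rwa [RatherBelow, compl_compl_compl]

theorem ratherBelow_of_disjoint_of_codisjoint (hac : Disjoint a c) (hcb : Codisjoint c b) :
    RatherBelow a b :=
  ratherBelow_iff_codisjoint.mpr (hcb.mono_left (le_compl_iff_disjoint_left.mpr hac))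

theorem directedOn_ratherBelow (a : L) : DirectedOn (· ≤ ·) {c | RatherBelow c a} :=
  fun x hx y hy => ⟨x ⊔ y, RatherBelow.sup hx hy, le_sup_left, le_sup_right⟩

namespace IsCompactRegular

variable (hL : IsCompactRegular L)
include hL

theorem isCompactElement_top : IsCompactElement (⊤ : L) := by
  rw [CompleteLattice.isCompactElement_iff_exists_le_sSup_of_le_sSup]
  intro S hS
  obtain ⟨T, hT, hTtop⟩ := hL.compact S (top_le_iff.mp hS)
  exact ⟨T, hT, by rw [Finset.sup_id_eq_sSup, hTtop]⟩

theorem exists_ratherBelow (h : Codisjoint a b) : ∃ c, RatherBelow c a ∧ Codisjoint c b :=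
  exists_codisjoint_of_directedOn hL.isCompactElement_top (S := {c | RatherBelow c a})
    ⟨⊥, ratherBelow_bot a⟩ (directedOn_ratherBelow a) (by rwa [← hL.regular a])

theorem exists_ratherBelow_not_le (h : ¬ a ≤ b) : ∃ c, RatherBelow c a ∧ ¬ c ≤ b := by
  by_contra! H
  exact h ((hL.regular a).le.trans (sSup_le H))

end IsCompactRegular

end Frames

section Topology

variable {X : Type u} [TopologicalSpace X] {x y : X} {U V : Set X}

theorem specLE_iff_specializes : SpecLE x y ↔ y ⤳ x := specializes_iff_forall_open.symm

theorem SpecLE.refl (x : X) : SpecLE x x := fun _ _ h => h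

theorem SpecLE.antisymm [T0Space X] (hxy : SpecLE x y) (hyx : SpecLE y x) : x = y :=
  ((specLE_iff_specializes.mp hyx).antisymm (specLE_iff_specializes.mp hxy)).eq

theorem compactSpace_of_forall_specLE (h : ∀ y, SpecLE x y) : CompactSpace X where
  isCompact_univ := by
    intro f _ _
    have hx : f ≤ 𝓝 x := fun s hs => by
      obtain ⟨U, hUs, hU, hxU⟩ := mem_nhds_iff.mp hs
      exact Filter.mem_of_superset Filter.univ_mem fun y _ => hUs (h y U hU hxU)
    exact ⟨x, trivial, .of_le_nhds hx⟩

theorem down_mono (h : U ⊆ V) : down U ⊆ down V := fun _ ⟨y, hy, hle⟩ => ⟨y, h hy, hle⟩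

theorem subset_down (U : Set X) : U ⊆ down U := fun x hx => ⟨x, hx, .refl x⟩

theorem upInterior_mono (h : U ⊆ V) : upInterior U ⊆ upInterior V :=
  fun _ hx y hy => h (hx y hy)

theorem subset_upInterior (hU : IsOpen U) (h : U ⊆ V) : U ⊆ upInterior V :=
  fun _ hx _ hy => h (hy U hU hx)

theorem upInterior_compl (U : Set X) : upInterior Uᶜ = (down U)ᶜ := by
  ext x
  simp only [upInterior, down, Set.mem_compl_iff, Set.mem_ofPred_eq, not_exists, not_and]
  exact forall_congr' fun _ => imp_not_comm

theorem closure_down (U : Set X) : closure (down U) = closure U := by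
  refine (closure_minimal ?_ isClosed_closure).antisymm (closure_mono (subset_down U))
  rintro x ⟨y, hy, hxy⟩
  exact mem_closure_iff.mpr fun V hV hxV => ⟨y, hxy V hV hxV, hy⟩

theorem isOpen_perp (U : Set X) : IsOpen (perp U) := isClosed_closure.isOpen_compl

theorem isRegularOpen_iff_interior_closure_eq : IsRegularOpen U ↔ interior (closure U) = U := by
  rw [IsRegularOpen, perp, perp, closure_compl, compl_compl]

theorem IsRegularOpen.isOpen (h : IsRegularOpen U) : IsOpen U := h ▸ isOpen_perp _

theorem isRegularOpen_univ : IsRegularOpen (Set.univ : Set X) := by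
  simp [isRegularOpen_iff_interior_closure_eq]

theorem isRegularOpen_interior_closure (U : Set X) : IsRegularOpen (interior (closure U)) :=
  isRegularOpen_iff_interior_closure_eq.mpr interior_closure_idem

theorem IsRegularOpen.inter (hU : IsRegularOpen U) (hV : IsRegularOpen V) :
    IsRegularOpen (U ∩ V) := by
  have hsub : interior (closure (U ∩ V)) ⊆ U ∩ V := by
    rw [isRegularOpen_iff_interior_closure_eq] at hU hV
    nth_rewrite 2 [← hU, ← hV]
    rw [← interior_inter]
    exact interior_mono (closure_inter_subset_inter_closure U V)
  exact isRegularOpen_iff_interior_closure_eq.mpr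
    (hsub.antisymm (hU.isOpen.inter hV.isOpen).subset_interior_closure)

theorem IsRegularOpen.isRegularClosed_compl (hU : IsRegularOpen U) : IsRegularClosed Uᶜ := by
  rw [IsRegularClosed, interior_compl, closure_compl, isRegularOpen_iff_interior_closure_eq.mp hU]

theorem isROFilter_regularNhds (x : X) : IsROFilter (regularNhds x) where
  regular _ hU := hU.1
  univ_mem := ⟨isRegularOpen_univ, trivial⟩
  inter_mem _ hU _ hV := ⟨hU.1.inter hV.1, hU.2, hV.2⟩
  mem_of_subset _ hU _ hV hUV := ⟨hV, hUV hU.2⟩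
  empty_notMem h := h.2

end Topology

section Maps

variable {X Y : Type u} [TopologicalSpace X] [TopologicalSpace Y] {f : X → Y} {U : Set Y}

theorem IsDVMap.preimage_down (hf : IsDVMap f) (hU : IsOpen U) :
    f ⁻¹' down U = down (f ⁻¹' U) := by
  ext x
  constructor
  · rintro ⟨y, hy, hxy⟩
    obtain ⟨x', hxx', hyx'⟩ := hf.weaklyDense x y hxy
    exact ⟨x', hyx' U hU hy, hxx'⟩
  · rintro ⟨x', hx', hxx'⟩
    exact ⟨f x', hx', hxx'.map hf.continuous⟩

theorem IsDVMap.preimage_upInterior_down (hf : IsDVMap f) (U : Set Y) :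
    f ⁻¹' upInterior (down U) = upInterior (f ⁻¹' down U) := by
  ext x
  refine ⟨fun hx x' hxx' => hx _ (hxx'.map hf.continuous), fun hx y hxy => ?_⟩
  obtain ⟨x', hxx', hyx'⟩ := hf.weaklyDense x y hxy
  obtain ⟨z, hz, hx'z⟩ := hx x' hxx'
  exact ⟨z, hz, fun V hV hyV => hx'z V hV (hyx' V hV hyV)⟩

theorem IsOrderRegularOpen.preimage (hU : IsOrderRegularOpen U) (hUo : IsOpen U)
    (hf : IsDVMap f) : IsOrderRegularOpen (f ⁻¹' U) := by
  rw [IsOrderRegularOpen, ← hf.preimage_down hUo, ← hf.preimage_upInterior_down, hU]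

theorem isDVMap_homeomorph (e : X ≃ₜ Y) : IsDVMap e where
  continuous := e.continuous
  weaklyDense x y h := ⟨e.symm y, by simpa using h.map e.symm.continuous, by simp [SpecLE.refl]⟩

theorem IsWellRounded.preimage (hU : IsWellRounded U) (e : X ≃ₜ Y) :
    IsWellRounded (e ⁻¹' U) where
  isOpen := hU.isOpen.preimage e.continuous
  separation B hB hBU := by
    have he := isDVMap_homeomorph e
    rw [← he.preimage_down hU.isOpen] at hBU ⊢
    obtain ⟨V, W, hV, hW, hVW, hBV, hWU⟩ := hU.separation (e '' B) (e.isClosedMap B hB)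
      (Set.image_subset_iff.mpr hBU)
    refine ⟨e ⁻¹' V, e ⁻¹' W, hV.preimage e.continuous, hW.preimage e.continuous,
      hVW.preimage e, ?_, Set.preimage_mono hWU⟩
    rwa [← he.preimage_down hV, ← Set.image_subset_iff]

end Maps

section Xi

variable {L : Type u} [Order.Frame L] {a c : L} {b b' : Xi L}

/-- The basic open sets of `Ξ(L)`: the points `b` with `a ∨ b = 1`. The set `{b | ¬a ≺ b}` of the
definition of `Ξ(L)` is `cobasic aᶜᶜ`. -/
def cobasic (a : L) : Set (Xi L) := {b | Codisjoint a b.1}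

/-- The points of `Ξ(L)` that are not above `a`. These sets are the downward closures of the open
sets. -/
def hit (a : L) : Set (Xi L) := {b | ¬ a ≤ b.1}

theorem mem_cobasic : b ∈ cobasic a ↔ Codisjoint a b.1 := Iff.rfl

theorem mem_hit : b ∈ hit a ↔ ¬ a ≤ b.1 := Iff.rfl

theorem mem_cobasic_compl : b ∈ cobasic aᶜ ↔ RatherBelow a b.1 :=
  ratherBelow_iff_codisjoint.symm

theorem cobasic_mono (h : a ≤ c) : cobasic a ⊆ cobasic c := fun _ hb => hb.mono_left h

theorem cobasic_subset_hit (a : L) : cobasic a ⊆ hit a :=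
  fun b hb hle => b.2 (hb.eq_top_of_ge hle)

theorem cobasic_inf (a c : L) : cobasic (a ⊓ c) = cobasic a ∩ cobasic c :=
  Set.ext fun _ => codisjoint_inf_left

theorem cobasic_top : cobasic (⊤ : L) = Set.univ :=
  Set.eq_univ_of_forall fun _ => codisjoint_top_left

theorem cobasic_bot : cobasic (⊥ : L) = ∅ :=
  Set.eq_empty_of_forall_notMem fun b hb => b.2 (bot_codisjoint.mp hb)

theorem disjoint_cobasic_compl (a : L) : Disjoint (cobasic a) (cobasic aᶜ) := by
  rw [Set.disjoint_iff_inter_eq_empty, ← cobasic_inf, inf_compl_self, cobasic_bot]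

theorem hit_sSup (S : Set L) : hit (sSup S) = ⋃ a ∈ S, hit a := by
  ext b
  simp only [mem_hit, sSup_le_iff, not_forall, exists_prop, Set.mem_iUnion]

theorem hit_subset_hit : hit a ⊆ hit c ↔ a ≤ c := by
  refine ⟨fun h => ?_, fun h _ hb hle => hb (h.trans hle)⟩
  by_contra hle
  exact h (show (⟨c, fun hc => hle (hc ▸ le_top)⟩ : Xi L) ∈ hit a from hle) le_rfl

theorem hit_injective : Function.Injective (hit : L → Set (Xi L)) := fun _ _ h =>
  le_antisymm (hit_subset_hit.mp h.subset) (hit_subset_hit.mp h.superset)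

variable (hL : IsCompactRegular L)
include hL

theorem exists_regular_mem_cobasic (hb : b ∈ cobasic a) :
    ∃ c : L, cᶜᶜ = c ∧ RatherBelow c a ∧ b ∈ cobasic c := by
  obtain ⟨c, hca, hcb⟩ := hL.exists_ratherBelow hb
  exact ⟨cᶜᶜ, compl_compl_compl _, hca.compl_compl, cobasic_mono le_compl_compl hcb⟩

theorem isOpen_cobasic (a : L) : IsOpen (cobasic a) := by
  rw [isOpen_iff_forall_mem_open]
  intro b hb
  obtain ⟨c, hc, hca, hbc⟩ := exists_regular_mem_cobasic hL hb
  refine ⟨cobasic c, cobasic_mono hca.le, isOpen_generateFrom_of_mem ⟨c, ?_⟩, hbc⟩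
  nth_rewrite 1 [← hc]
  exact Set.ext fun b => mem_cobasic_compl

theorem isTopologicalBasis_cobasic :
    IsTopologicalBasis (Set.range (cobasic : L → Set (Xi L))) where
  exists_subset_inter := by
    rintro _ ⟨a, rfl⟩ _ ⟨c, rfl⟩ b hb
    exact ⟨cobasic (a ⊓ c), ⟨_, rfl⟩, by rwa [cobasic_inf], by rw [cobasic_inf]⟩
  sUnion_eq := Set.eq_univ_of_univ_subset (Set.subset_sUnion_of_mem ⟨⊤, cobasic_top⟩)
  eq_generateFrom := by
    refine le_antisymm (le_generateFrom ?_) (le_generateFrom ?_)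
    · rintro _ ⟨a, rfl⟩
      exact isOpen_cobasic hL a
    · rintro _ ⟨a, rfl⟩
      exact isOpen_generateFrom_of_mem ⟨aᶜᶜ, Set.ext fun b => mem_cobasic_compl⟩

theorem specLE_iff : SpecLE b b' ↔ b.1 ≤ b'.1 := by
  refine ⟨fun h => ?_, fun h U hU hb => ?_⟩
  · rw [hL.regular b.1]
    refine sSup_le fun c hc => RatherBelow.le ?_
    exact mem_cobasic_compl.mp (h _ (isOpen_cobasic hL _) (mem_cobasic_compl.mpr hc))
  · obtain ⟨_, ⟨a, rfl⟩, hba, haU⟩ :=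
      (isTopologicalBasis_cobasic hL).exists_subset_of_mem_open hb hU
    exact haU (hba.mono_right h)

theorem down_cobasic (a : L) : down (cobasic a) = hit a := by
  ext b
  constructor
  · rintro ⟨b', hb', hle⟩ hab
    exact cobasic_subset_hit a hb' (hab.trans ((specLE_iff hL).mp hle))
  · intro hab
    obtain ⟨c, hca, hcb⟩ := hL.exists_ratherBelow_not_le hab
    refine ⟨⟨b.1 ⊔ cᶜ, fun h => hcb (RatherBelow.le h)⟩, ?_, (specLE_iff hL).mpr le_sup_left⟩
    exact (ratherBelow_iff_codisjoint.mp hca).symm.mono_right le_sup_right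

theorem upInterior_hit (a : L) : upInterior (hit a) = cobasic a := by
  refine Set.Subset.antisymm (fun b h => ?_)
    (subset_upInterior (isOpen_cobasic hL a) (cobasic_subset_hit a))
  by_contra hb
  exact h ⟨a ⊔ b.1, fun hab => hb (codisjoint_iff.mpr hab)⟩ ((specLE_iff hL).mpr le_sup_right)
    le_sup_left

theorem cobasic_subset_cobasic : cobasic a ⊆ cobasic c ↔ a ≤ c := by
  refine ⟨fun h => hit_subset_hit.mp ?_, cobasic_mono⟩
  rw [← down_cobasic hL, ← down_cobasic hL]
  exact down_mono h

theorem cobasic_injective : Function.Injective (cobasic : L → Set (Xi L)) := fun _ _ h =>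
  le_antisymm ((cobasic_subset_cobasic hL).mp h.subset)
    ((cobasic_subset_cobasic hL).mp h.superset)

theorem disjoint_cobasic_iff : Disjoint (cobasic a) (cobasic c) ↔ Disjoint a c := by
  rw [Set.disjoint_iff_inter_eq_empty, ← cobasic_inf, ← cobasic_bot,
    (cobasic_injective hL).eq_iff, disjoint_iff]

theorem perp_cobasic (a : L) : perp (cobasic a) = cobasic aᶜ := by
  refine Set.Subset.antisymm (fun b hb => ?_) (Set.subset_compl_comm.mp
    (closure_minimal (disjoint_cobasic_compl a).subset_compl_right
      (isOpen_cobasic hL _).isClosed_compl))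
  obtain ⟨_, ⟨c, rfl⟩, hbc, hc⟩ :=
    (isTopologicalBasis_cobasic hL).exists_subset_of_mem_open hb (isOpen_perp _)
  have hca : Disjoint (cobasic c) (cobasic a) :=
    Set.disjoint_left.mpr fun _ hbc hba => hc hbc (subset_closure hba)
  exact cobasic_mono (le_compl_iff_disjoint_right.mpr ((disjoint_cobasic_iff hL).mp hca)) hbc

theorem exists_down_eq_hit {U : Set (Xi L)} (hU : IsOpen U) : ∃ a, down U = hit a := by
  refine ⟨sSup {a | cobasic a ⊆ U}, ?_⟩
  rw [hit_sSup]
  refine Set.Subset.antisymm ?_ (Set.iUnion₂_subset fun a ha => down_cobasic hL a ▸ down_mono ha)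
  rintro b ⟨b', hb', hle⟩
  obtain ⟨_, ⟨a, rfl⟩, hb'a, haU⟩ :=
    (isTopologicalBasis_cobasic hL).exists_subset_of_mem_open hb' hU
  exact Set.mem_biUnion (show a ∈ {a | cobasic a ⊆ U} from haU)
    (down_cobasic hL a ▸ ⟨b', hb'a, hle⟩)

theorem exists_perp_eq_cobasic_compl {U : Set (Xi L)} (hU : IsOpen U) :
    ∃ a, perp U = cobasic aᶜ := by
  obtain ⟨a, ha⟩ := exists_down_eq_hit hL hU
  exact ⟨a, by rw [perp, ← closure_down, ha, ← down_cobasic hL, closure_down, ← perp,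
    perp_cobasic hL]⟩

theorem isRegularOpen_cobasic : IsRegularOpen (cobasic a) ↔ aᶜᶜ = a := by
  rw [IsRegularOpen, perp_cobasic hL, perp_cobasic hL, (cobasic_injective hL).eq_iff]

theorem isRegularOpen_iff_exists_cobasic {U : Set (Xi L)} :
    IsRegularOpen U ↔ ∃ a : L, aᶜᶜ = a ∧ U = cobasic a := by
  constructor
  · intro h
    obtain ⟨a, ha⟩ := exists_perp_eq_cobasic_compl hL (isOpen_perp U)
    exact ⟨aᶜ, compl_compl_compl a, h.symm.trans ha⟩
  · rintro ⟨a, ha, rfl⟩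
    exact (isRegularOpen_cobasic hL).mpr ha

theorem wayInside_cobasic : WayInside (cobasic a) (cobasic c) ↔ RatherBelow a c := by
  rw [WayInside, ← compl_compl (closure _), ← perp, perp_cobasic hL, down_cobasic hL]
  constructor
  · intro h
    by_contra hn
    have hmem : (⟨c ⊔ aᶜ, hn⟩ : Xi L) ∈ (cobasic aᶜ)ᶜ :=
      fun h' => hn (h'.eq_top_of_ge le_sup_right)
    exact h hmem le_sup_left
  · exact fun h b hb hcb => hb (mem_cobasic_compl.mpr (h.trans_le hcb))

theorem exists_ratherBelow_subset_hit {A : Set (Xi L)} (hA : IsClosed A) (h : A ⊆ hit a) :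
    ∃ c, RatherBelow c a ∧ A ⊆ hit c := by
  by_cases ha : a = ⊤
  · exact ⟨a, by rw [RatherBelow, ha, top_sup_eq], h⟩
  -- The point `a` of `Ξ(L)` lies outside `A`, hence has a neighbourhood `cobasic d` outside `A`.
  have haA : (⟨a, ha⟩ : Xi L) ∈ Aᶜ := fun h' => h h' le_rfl
  obtain ⟨_, ⟨d, rfl⟩, had, hd⟩ :=
    (isTopologicalBasis_cobasic hL).exists_subset_of_mem_open haA hA.isOpen_compl
  obtain ⟨c, hca, hcd⟩ := hL.exists_ratherBelow (mem_cobasic.mp had).symm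
  exact ⟨c, hca, fun b hb hcb => hd (hcd.symm.mono_right hcb) hb⟩

theorem exists_disjoint_isOpen_of_subset_hit {A : Set (Xi L)} (hA : IsClosed A)
    (h : A ⊆ hit a) : ∃ V W : Set (Xi L),
      IsOpen V ∧ IsOpen W ∧ Disjoint V W ∧ A ⊆ down V ∧ (hit a)ᶜ ⊆ W := by
  obtain ⟨c, hca, hAc⟩ := exists_ratherBelow_subset_hit hL hA h
  refine ⟨cobasic c, cobasic cᶜ, isOpen_cobasic hL _, isOpen_cobasic hL _,
    disjoint_cobasic_compl c, by rwa [down_cobasic hL], fun b hb => ?_⟩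
  exact mem_cobasic_compl.mpr (hca.trans_le (not_not.mp hb))

theorem isWellRounded_cobasic (a : L) : IsWellRounded (cobasic a) where
  isOpen := isOpen_cobasic hL a
  separation B hB hBa := by
    rw [down_cobasic hL] at hBa ⊢
    obtain ⟨V, W, hV, hW, hVW, hBV, haW⟩ := exists_disjoint_isOpen_of_subset_hit hL hB hBa
    exact ⟨V, W, hV, hW, hVW, hBV, Set.compl_subset_comm.mp haW⟩

theorem isOrderRegularOpen_cobasic (a : L) : IsOrderRegularOpen (cobasic a) := by
  rw [IsOrderRegularOpen, down_cobasic hL, upInterior_hit hL]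

theorem exists_eq_cobasic {U : Set (Xi L)} (hU : IsOpen U) (hU' : IsOrderRegularOpen U) :
    ∃ a, U = cobasic a := by
  obtain ⟨a, ha⟩ := exists_down_eq_hit hL hU
  exact ⟨a, by rw [← hU', ha, upInterior_hit hL]⟩

theorem isOrderNormal_xi : IsOrderNormal (Xi L) := by
  intro A B hA hB hAB
  obtain ⟨a, ha⟩ := exists_perp_eq_cobasic_compl hL (isOpen_interior (s := B))
  have hBa : upInterior B = (hit aᶜ)ᶜ := by
    rw [← down_cobasic hL, ← ha, perp, hB, ← upInterior_compl, compl_compl]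
  rw [hBa] at hAB ⊢
  exact exists_disjoint_isOpen_of_subset_hit hL hA
    (Set.disjoint_compl_right_iff_subset.mp hAB)

theorem t0Space_xi : T0Space (Xi L) where
  t0 _ _ h := Subtype.ext (le_antisymm
    ((specLE_iff hL).mp (specLE_iff_specializes.mpr h.specializes'))
    ((specLE_iff hL).mp (specLE_iff_specializes.mpr h.specializes)))

theorem compactSpace_xi : CompactSpace (Xi L) := by
  rcases isEmpty_or_nonempty (Xi L) with _ | ⟨⟨b, hb⟩⟩
  · infer_instance
  · exact compactSpace_of_forall_specLE (x := ⟨⊥, ne_top_of_le_ne_top hb bot_le⟩)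
      fun _ => (specLE_iff hL).mpr bot_le

theorem isTopologicalBasis_isRegularOpen_xi :
    IsTopologicalBasis {U : Set (Xi L) | IsRegularOpen U} := by
  refine isTopologicalBasis_of_isOpen_of_nhds (fun U hU => hU.isOpen) fun b U hb hU => ?_
  obtain ⟨_, ⟨a, rfl⟩, hba, ha⟩ :=
    (isTopologicalBasis_cobasic hL).exists_subset_of_mem_open hb hU
  obtain ⟨c, hc, hca, hbc⟩ := exists_regular_mem_cobasic hL hba
  exact ⟨cobasic c, (isRegularOpen_cobasic hL).mpr hc, hbc, (cobasic_mono hca.le).trans ha⟩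

theorem isConcordant_regularNhds_xi (b : Xi L) : IsConcordant (regularNhds b) where
  isROFilter := isROFilter_regularNhds b
  roundPart_eq := by
    refine Set.Subset.antisymm (fun U hU => hU.1) fun U hU => ⟨hU, ?_⟩
    obtain ⟨a, -, rfl⟩ := (isRegularOpen_iff_exists_cobasic hL).mp hU.1
    obtain ⟨c, hc, hca, hbc⟩ := exists_regular_mem_cobasic hL hU.2
    exact ⟨cobasic c, ⟨(isRegularOpen_cobasic hL).mpr hc, hbc⟩, (wayInside_cobasic hL).mpr hca⟩

omit hL in
theorem directedOn_compl_of_cobasic_mem {F : Set (Set (Xi L))} (hF : IsROFilter F) :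
    DirectedOn (· ≤ ·) (compl '' {c : L | cobasic c ∈ F}) := by
  rintro _ ⟨c, hc, rfl⟩ _ ⟨d, hd, rfl⟩
  refine ⟨_, ⟨c ⊓ d, ?_, rfl⟩, compl_le_compl inf_le_left, compl_le_compl inf_le_right⟩
  rw [Set.mem_ofPred_eq, cobasic_inf]
  exact hF.inter_mem _ hc _ hd

/-- The limit of `F` is the join of the complements `¬c` for `cobasic c ∈ F`, which is a point
by compactness. -/
theorem exists_roundPart_eq_regularNhds_xi {F : Set (Set (Xi L))} (hF : IsROFilter F) :
    ∃ b : Xi L, roundPart F = regularNhds b := by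
  let S : Set L := compl '' {c : L | cobasic c ∈ F}
  have hne : S.Nonempty :=
    ⟨_, ⊤, by rw [Set.mem_ofPred_eq, cobasic_top]; exact hF.univ_mem, rfl⟩
  have exists_ratherBelow {a : L} (h : Codisjoint a (sSup S)) :
      ∃ c, cobasic c ∈ F ∧ RatherBelow c a := by
    obtain ⟨_, ⟨c, hc, rfl⟩, hca⟩ := exists_codisjoint_of_directedOn hL.isCompactElement_top hne
      (directedOn_compl_of_cobasic_mem hF) h.symm
    exact ⟨c, hc, ratherBelow_iff_codisjoint.mpr hca⟩
  have hS : sSup S ≠ ⊤ := by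
    intro h
    obtain ⟨c, hc, hcbot⟩ := exists_ratherBelow (bot_codisjoint.mpr h)
    rw [le_bot_iff.mp hcbot.le, cobasic_bot] at hc
    exact hF.empty_notMem hc
  refine ⟨⟨sSup S, hS⟩, Set.Subset.antisymm ?_ ?_⟩
  · rintro V ⟨hV, U, hU, hUV⟩
    obtain ⟨a, -, rfl⟩ := (isRegularOpen_iff_exists_cobasic hL).mp (hF.regular V hV)
    obtain ⟨c, -, rfl⟩ := (isRegularOpen_iff_exists_cobasic hL).mp (hF.regular U hU)
    have hca := ratherBelow_iff_codisjoint.mp ((wayInside_cobasic hL).mp hUV)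
    have hcS : cᶜ ≤ sSup S := le_sSup (Set.mem_image_of_mem _ hU)
    exact ⟨hF.regular _ hV, (hca.mono_left hcS).symm⟩
  · rintro V ⟨hV, hbV⟩
    obtain ⟨a, -, rfl⟩ := (isRegularOpen_iff_exists_cobasic hL).mp hV
    obtain ⟨c, hc, hca⟩ := exists_ratherBelow hbV
    exact ⟨hF.mem_of_subset _ hc _ hV (cobasic_mono hca.le), _, hc,
      (wayInside_cobasic hL).mpr hca⟩

theorem isDVSpace_xi : IsDVSpace (Xi L) where
  t0 := t0Space_xi hL
  compact := compactSpace_xi hL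
  orderNormal := isOrderNormal_xi hL
  basis := isTopologicalBasis_isRegularOpen_xi hL
  orderRegular _ hU := by
    obtain ⟨a, -, rfl⟩ := (isRegularOpen_iff_exists_cobasic hL).mp hU
    exact isOrderRegularOpen_cobasic hL a
  concordant := isConcordant_regularNhds_xi hL
  exists_point _ := exists_roundPart_eq_regularNhds_xi hL

/-- The isomorphism between a compact regular frame and the poset of well-rounded order-regular
open subsets of `Ξ(L)`, given by `cobasic`. -/
noncomputable def cobasicIso : L ≃o WORO (Xi L) where
  toEquiv := Equiv.ofBijective
    (fun a => ⟨cobasic a, isWellRounded_cobasic hL a, isOrderRegularOpen_cobasic hL a⟩)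
    ⟨fun _ _ h => cobasic_injective hL (congrArg Subtype.val h), fun U =>
      (exists_eq_cobasic hL U.2.1.isOpen U.2.2).imp fun _ ha => Subtype.ext ha.symm⟩
  map_rel_iff' := cobasic_subset_cobasic hL

end Xi

section XiMap

variable {L M : Type u} [Order.Frame L] [Order.Frame M]

theorem xiMap_injective : Function.Injective (Xi.map : FrameHom L M → Xi M → Xi L) := by
  intro h k H
  have hr (b : M) : rightAdjoint h b = rightAdjoint k b := by
    by_cases hb : b = ⊤
    · rw [hb, (gc_rightAdjoint h).u_top, (gc_rightAdjoint k).u_top]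
    · exact congrArg Subtype.val (congrFun H ⟨b, hb⟩)
  exact DFunLike.ext _ _ fun a => (gc_rightAdjoint h).l_unique (gc_rightAdjoint k) hr

variable (hL : IsCompactRegular L) (hM : IsCompactRegular M)
include hL hM

theorem codisjoint_rightAdjoint_iff (h : FrameHom L M) (a : L) (b : M) :
    Codisjoint a (rightAdjoint h b) ↔ Codisjoint (h a) b := by
  refine ⟨fun H => (H.map h).mono_right ((gc_rightAdjoint h).l_u_le b), fun H => ?_⟩
  rw [hL.regular a, map_sSup] at H
  obtain ⟨_, ⟨c, hca, rfl⟩, hcb⟩ := exists_codisjoint_of_directedOn hM.isCompactElement_top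
    (Set.Nonempty.image h ⟨⊥, ratherBelow_bot a⟩)
    ((directedOn_ratherBelow a).mono_comp fun _ _ hxy => OrderHomClass.mono h hxy) H
  have hcb' : h cᶜ ≤ b := (disjoint_compl_left.map h).le_of_codisjoint hcb
  exact ((ratherBelow_iff_codisjoint.mp hca).mono_left ((gc_rightAdjoint h).le_u hcb')).symm

theorem preimage_xiMap_cobasic (h : FrameHom L M) (a : L) :
    Xi.map h ⁻¹' cobasic a = cobasic (h a) :=
  Set.ext fun b => codisjoint_rightAdjoint_iff hL hM h a b.1

theorem isDVMap_xiMap (h : FrameHom L M) : IsDVMap (Xi.map h) where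
  continuous := by
    refine (isTopologicalBasis_cobasic hL).continuous_iff.mpr ?_
    rintro _ ⟨a, rfl⟩
    rw [preimage_xiMap_cobasic hL hM]
    exact isOpen_cobasic hM _
  weaklyDense b y hy := by
    have hle : rightAdjoint h b.1 ≤ y.1 := (specLE_iff hL).mp hy
    have hne : h y.1 ⊔ b.1 ≠ ⊤ := fun H => y.2 <|
      ((codisjoint_rightAdjoint_iff hL hM h _ _).mpr (codisjoint_iff.mpr H)).eq_top_of_le hle
    exact ⟨⟨h y.1 ⊔ b.1, hne⟩, (specLE_iff hM).mpr le_sup_right,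
      (specLE_iff hL).mpr ((gc_rightAdjoint h).le_u le_sup_left)⟩

theorem exists_frameHom_preimage_cobasic {g : Xi M → Xi L} (hg : IsDVMap g) :
    ∃ h : FrameHom L M, ∀ a, g ⁻¹' cobasic a = cobasic (h a) := by
  have hex (a : L) : ∃ c : M, g ⁻¹' cobasic a = cobasic c :=
    exists_eq_cobasic hM ((isOpen_cobasic hL a).preimage hg.continuous)
      ((isOrderRegularOpen_cobasic hL a).preimage (isOpen_cobasic hL a) hg)
  choose φ hφ using hex
  have hφ_hit (a : L) : hit (φ a) = g ⁻¹' hit a := by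
    rw [← down_cobasic hL, ← down_cobasic hM, hg.preimage_down (isOpen_cobasic hL a), hφ]
  let h : FrameHom L M :=
    { toFun := φ
      map_inf' a c := cobasic_injective hM (by
        rw [cobasic_inf, ← hφ, ← hφ, ← hφ, cobasic_inf, Set.preimage_inter])
      map_top' := cobasic_injective hM (by rw [← hφ, cobasic_top, cobasic_top, Set.preimage_univ])
      map_sSup' S := hit_injective (by
        simp only [hφ_hit, hit_sSup, Set.biUnion_image, Set.preimage_iUnion₂]) }
  exact ⟨h, hφ⟩

theorem exists_xiMap_eq {g : Xi M → Xi L} (hg : IsDVMap g) :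
    ∃ h : FrameHom L M, Xi.map h = g := by
  obtain ⟨h, hh⟩ := exists_frameHom_preimage_cobasic hL hM hg
  have := t0Space_xi hL
  refine ⟨h, funext fun b => ((isTopologicalBasis_cobasic hL).inseparable_iff.mpr ?_).eq⟩
  rintro _ ⟨a, rfl⟩
  exact Set.ext_iff.mp ((preimage_xiMap_cobasic hL hM h a).trans (hh a).symm) b

end XiMap

section RoundIdeals

theorem mem_sSup_ideal {P : Type*} [SemilatticeSup P] [OrderBot P] {S : Set (Order.Ideal P)}
    {a : P} : a ∈ sSup S ↔ ∃ t : Finset P, (∀ b ∈ t, ∃ I ∈ S, b ∈ I) ∧ a ≤ t.sup id := by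
  classical
  let J : Set P := {a | ∃ t : Finset P, (∀ b ∈ t, ∃ I ∈ S, b ∈ I) ∧ a ≤ t.sup id}
  have hJ : Order.IsIdeal J :=
    { IsLowerSet := fun _ _ hba ⟨t, ht, hat⟩ => ⟨t, ht, hba.trans hat⟩
      Nonempty := ⟨⊥, ∅, by simp, bot_le⟩
      Directed := fun a ⟨t, ht, hat⟩ b ⟨s, hs, hbs⟩ => by
        refine ⟨a ⊔ b, ⟨t ∪ s, fun c hc => ?_, ?_⟩, le_sup_left, le_sup_right⟩
        · exact (Finset.mem_union.mp hc).elim (ht c) (hs c)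
        · rw [Finset.sup_union]
          exact sup_le_sup hat hbs }
  have hSJ : sSup S ≤ hJ.toIdeal :=
    sSup_le fun I hI b hb => ⟨{b}, by simpa using ⟨I, hI, hb⟩, by simp⟩
  refine ⟨fun ha => hSJ ha, fun ⟨t, ht, hat⟩ => ?_⟩
  refine (sSup S).lower hat ((Order.Ideal.finsetSup_mem_iff _).mpr fun b hb => ?_)
  obtain ⟨I, hI, hbI⟩ := ht b hb
  exact le_sSup hI hbI

/-- De Vries proximities on a Boolean algebra, except that the axiom `b = ⋁ {a | r a b}` is not
imposed. -/
structure IsProximity {B : Type u} [BooleanAlgebra B] (r : B → B → Prop) : Prop where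
  bot : r ⊥ ⊥
  le : ∀ {a b}, r a b → a ≤ b
  mono : ∀ {a a' b b'}, a' ≤ a → r a b → b ≤ b' → r a' b'
  inf : ∀ {a b c}, r a b → r a c → r a (b ⊓ c)
  compl : ∀ {a b}, r a b → r bᶜ aᶜ
  interpolate : ∀ {a b}, r a b → ∃ c, r a c ∧ r c b

variable {B : Type u} [BooleanAlgebra B] {r : B → B → Prop}

namespace IsProximity

variable (hr : IsProximity r)
include hr

theorem top : r ⊤ ⊤ := by
  simpa only [compl_bot] using hr.compl hr.bot

theorem bot_left (b : B) : r ⊥ b := hr.mono le_rfl hr.bot bot_le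

theorem sup {a b c : B} (ha : r a c) (hb : r b c) : r (a ⊔ b) c := by
  simpa only [compl_inf, compl_compl] using hr.compl (hr.inf (hr.compl ha) (hr.compl hb))

theorem finsetSup {t : Finset B} {c : B} (ht : ∀ b ∈ t, r b c) : r (t.sup id) c :=
  Finset.sup_induction (p := (r · c)) (hr.bot_left c) (fun _ ha _ hb => hr.sup ha hb) ht

end IsProximity

/-- Roundness of an ideal with respect to `r`: each member is `r`-related to some member. -/
def IsRound (r : B → B → Prop) (I : Order.Ideal B) : Prop := ∀ a ∈ I, ∃ b ∈ I, r a b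

namespace IsRound

variable (hr : IsProximity r)
include hr

theorem inf {I J : Order.Ideal B} (hI : IsRound r I) (hJ : IsRound r J) : IsRound r (I ⊓ J) := by
  intro a ha
  obtain ⟨b, hb, hab⟩ := hI a ha.1
  obtain ⟨c, hc, hac⟩ := hJ a ha.2
  exact ⟨b ⊓ c, ⟨I.lower inf_le_left hb, J.lower inf_le_right hc⟩, hr.inf hab hac⟩

theorem sSup {S : Set (Order.Ideal B)} (hS : ∀ I ∈ S, IsRound r I) : IsRound r (sSup S) := by
  classical
  intro a ha
  obtain ⟨t, ht, hat⟩ := mem_sSup_ideal.mp ha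
  have hround : ∀ b ∈ t, ∃ c, (∃ I ∈ S, c ∈ I) ∧ r b c := fun b hb => by
    obtain ⟨I, hI, hbI⟩ := ht b hb
    obtain ⟨c, hc, hbc⟩ := hS I hI b hbI
    exact ⟨c, ⟨I, hI, hc⟩, hbc⟩
  choose! g hgS hg using hround
  refine ⟨(t.image g).sup id, mem_sSup_ideal.mpr ⟨t.image g, ?_, le_rfl⟩, ?_⟩
  · exact Finset.forall_mem_image.mpr hgS
  · refine hr.mono hat (hr.finsetSup fun b hb => hr.mono le_rfl (hg b hb) ?_) le_rfl
    exact Finset.le_sup (f := id) (Finset.mem_image_of_mem g hb)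

theorem sup {I J : Order.Ideal B} (hI : IsRound r I) (hJ : IsRound r J) : IsRound r (I ⊔ J) := by
  rw [← sSup_pair]
  exact IsRound.sSup hr (by rintro _ (rfl | rfl) <;> assumption)

end IsRound

/-- Round ideals of a Boolean algebra with a proximity, ordered by inclusion. -/
@[ext]
structure RoundIdeal (hr : IsProximity r) : Type u where
  toIdeal : Order.Ideal B
  isRound : IsRound r toIdeal

namespace RoundIdeal

variable {hr : IsProximity r} {I J : RoundIdeal hr} {a b : B}

instance : PartialOrder (RoundIdeal hr) :=
  PartialOrder.lift toIdeal fun _ _ => RoundIdeal.ext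

theorem toIdeal_le_toIdeal : I.toIdeal ≤ J.toIdeal ↔ I ≤ J := Iff.rfl

theorem mem_of_le (h : a ≤ b) (hb : b ∈ I.toIdeal) : a ∈ I.toIdeal := I.toIdeal.lower h hb

instance : SupSet (RoundIdeal hr) where
  sSup S := ⟨sSup (toIdeal '' S),
    IsRound.sSup hr (Set.forall_mem_image.mpr fun I _ => I.isRound)⟩

instance : CompleteLattice (RoundIdeal hr) where
  inf I J := ⟨I.toIdeal ⊓ J.toIdeal, IsRound.inf hr I.isRound J.isRound⟩
  inf_le_left I _ := inf_le_left (a := I.toIdeal)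
  inf_le_right I _ := inf_le_right (a := I.toIdeal)
  le_inf _ _ _ h h' := le_inf (α := Order.Ideal B) h h'
  sup I J := ⟨I.toIdeal ⊔ J.toIdeal, IsRound.sup hr I.isRound J.isRound⟩
  le_sup_left I _ := le_sup_left (a := I.toIdeal)
  le_sup_right I _ := le_sup_right (a := I.toIdeal)
  sup_le _ _ _ h h' := sup_le (α := Order.Ideal B) h h'
  __ := completeLatticeOfSup (RoundIdeal hr) fun _ =>
    ⟨fun _ hI => le_sSup (α := Order.Ideal B) (Set.mem_image_of_mem _ hI),
      fun _ hJ => sSup_le (α := Order.Ideal B) (Set.forall_mem_image.mpr hJ)⟩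

theorem mem_inf : a ∈ (I ⊓ J).toIdeal ↔ a ∈ I.toIdeal ∧ a ∈ J.toIdeal := Iff.rfl

theorem mem_sup : a ∈ (I ⊔ J).toIdeal ↔ ∃ b ∈ I.toIdeal, ∃ c ∈ J.toIdeal, a ≤ b ⊔ c := Iff.rfl

theorem mem_sSup {S : Set (RoundIdeal hr)} :
    a ∈ (sSup S).toIdeal ↔ ∃ t : Finset B, (∀ b ∈ t, ∃ I ∈ S, b ∈ I.toIdeal) ∧ a ≤ t.sup id :=
  mem_sSup_ideal.trans (by simp only [Set.exists_mem_image])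

instance : Order.Frame (RoundIdeal hr) :=
  Order.Frame.ofMinimalAxioms
    { inf_sSup_le_iSup_inf := by
        rintro I S a ⟨haI, ha⟩
        obtain ⟨t, ht, hat⟩ := mem_sSup.mp ha
        rw [← inf_eq_left.mpr hat, Finset.sup_inf_distrib_left]
        refine (Order.Ideal.finsetSup_mem_iff _).mpr fun b hb => ?_
        obtain ⟨J, hJ, hbJ⟩ := ht b hb
        exact le_iSup₂ (f := fun J (_ : J ∈ S) => I ⊓ J) J hJ
          (mem_inf.mpr ⟨mem_of_le inf_le_left haI, mem_of_le inf_le_right hbJ⟩) }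

/-- The principal round ideal of the elements in proximity to `b`. -/
def principal (hr : IsProximity r) (b : B) : RoundIdeal hr where
  toIdeal :=
    { carrier := {a | r a b}
      lower' := fun _ _ h ha => hr.mono h ha le_rfl
      nonempty' := ⟨⊥, hr.bot_left b⟩
      directed' := fun a ha c hc => ⟨a ⊔ c, hr.sup ha hc, le_sup_left, le_sup_right⟩ }
  isRound _ ha := by
    obtain ⟨c, hac, hcb⟩ := hr.interpolate ha
    exact ⟨c, hcb, hac⟩

theorem mem_principal : a ∈ (principal hr b).toIdeal ↔ r a b := Iff.rfl

theorem top_mem_iff_eq_top : ⊤ ∈ I.toIdeal ↔ I = ⊤ := by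
  constructor
  · exact fun h => top_le_iff.mp (toIdeal_le_toIdeal.mp fun a _ => mem_of_le le_top h)
  · rintro rfl
    exact toIdeal_le_toIdeal.mpr (le_top (a := principal hr ⊤)) hr.top

theorem codisjoint_iff : Codisjoint I J ↔ ∃ a ∈ I.toIdeal, ∃ b ∈ J.toIdeal, Codisjoint a b := by
  simp only [_root_.codisjoint_iff, ← top_mem_iff_eq_top, mem_sup, top_le_iff]

theorem disjoint_principal_compl (b : B) : Disjoint (principal hr b) (principal hr bᶜ) := by
  refine disjoint_iff_inf_le.mpr (toIdeal_le_toIdeal.mp fun a ha => ?_)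
  have hle : a ≤ b ⊓ bᶜ := le_inf (hr.le ha.1) (hr.le ha.2)
  rw [inf_compl_self, le_bot_iff] at hle
  exact hle ▸ Order.Ideal.bot_mem _

theorem principal_ratherBelow (hb : b ∈ I.toIdeal) : RatherBelow (principal hr b) I := by
  obtain ⟨d, hd, hbd⟩ := I.isRound b hb
  obtain ⟨e, hbe, hed⟩ := hr.interpolate hbd
  exact ratherBelow_of_disjoint_of_codisjoint (disjoint_principal_compl b) <|
    codisjoint_iff.mpr ⟨eᶜ, hr.compl hbe, e, mem_of_le (hr.le hed) hd,
      isCompl_compl.symm.codisjoint⟩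

theorem isCompactRegular : IsCompactRegular (RoundIdeal hr) where
  compact S hS := by
    classical
    obtain ⟨t, ht, htop⟩ := mem_sSup.mp (top_mem_iff_eq_top.mpr hS)
    choose! K hKS hK using ht
    refine ⟨t.image K, by simpa [Set.subset_def] using hKS, top_mem_iff_eq_top.mp ?_⟩
    exact mem_sSup.mpr ⟨t, fun b hb => ⟨K b, Finset.mem_image_of_mem K hb, hK b hb⟩, htop⟩
  regular I := by
    refine le_antisymm (toIdeal_le_toIdeal.mp fun a ha => ?_)
      (sSup_le fun _ hJ => RatherBelow.le hJ)
    obtain ⟨b, hb, hab⟩ := I.isRound a ha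
    have hle : principal hr b ≤ sSup {J | RatherBelow J I} := le_sSup (principal_ratherBelow hb)
    exact toIdeal_le_toIdeal.mpr hle (mem_principal.mpr hab)

end RoundIdeal

end RoundIdeals

section RegularOpens

variable {X : Type u} [TopologicalSpace X]

theorem perp_eq_coe_compl (U : Opens X) : perp (U : Set X) = ((Uᶜ : Opens X) : Set X) := by
  rw [Opens.coe_compl_eq_interior_compl, interior_compl, perp]

theorem isRegularOpen_coe_iff (U : Opens X) : IsRegularOpen (U : Set X) ↔ Heyting.IsRegular U := by
  rw [IsRegularOpen, perp_eq_coe_compl, perp_eq_coe_compl, SetLike.coe_set_eq, Heyting.IsRegular]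

variable (X) in
/-- The Boolean algebra of regular open subsets of a space. -/
abbrev RegOpens : Type u := Heyting.Regular (Opens X)

namespace RegOpens

/-- The underlying set of a regular open set. -/
def set (a : RegOpens X) : Set X := (a.val : Set X)

/-- The bundling of a regular open set. -/
def mk (U : Set X) (hU : IsRegularOpen U) : RegOpens X :=
  ⟨⟨U, hU.isOpen⟩, (isRegularOpen_coe_iff _).mp hU⟩

variable {a b : RegOpens X}

theorem isRegularOpen (a : RegOpens X) : IsRegularOpen a.set :=
  (isRegularOpen_coe_iff a.val).mpr a.prop

theorem isOpen (a : RegOpens X) : IsOpen a.set := a.isRegularOpen.isOpen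

theorem set_mk (U : Set X) (hU : IsRegularOpen U) : (mk U hU).set = U := rfl

theorem set_subset_set : a.set ⊆ b.set ↔ a ≤ b := Iff.rfl

theorem set_injective : Function.Injective (set : RegOpens X → Set X) :=
  fun _ _ h => le_antisymm h.subset h.superset

theorem set_compl (a : RegOpens X) : (aᶜ).set = perp a.set := (perp_eq_coe_compl a.val).symm

theorem set_top : (⊤ : RegOpens X).set = Set.univ := rfl

theorem set_bot : (⊥ : RegOpens X).set = ∅ := rfl

end RegOpens

theorem isROFilter_of_mem_closure {U : Set X} {x : X} (hx : x ∈ closure U) :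
    IsROFilter {V | IsRegularOpen V ∧ ∃ G ∈ regularNhds x, G ∩ U ⊆ V} where
  regular _ hV := hV.1
  univ_mem := ⟨isRegularOpen_univ, _, (isROFilter_regularNhds x).univ_mem, Set.subset_univ _⟩
  inter_mem := fun _ ⟨hV, G, hG, hGV⟩ _ ⟨hW, H, hH, hHW⟩ =>
    ⟨hV.inter hW, G ∩ H, (isROFilter_regularNhds x).inter_mem _ hG _ hH,
      fun _ hz => ⟨hGV ⟨hz.1.1, hz.2⟩, hHW ⟨hz.1.2, hz.2⟩⟩⟩
  mem_of_subset := fun _ ⟨_, G, hG, hGV⟩ _ hW hVW => ⟨hW, G, hG, hGV.trans hVW⟩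
  empty_notMem := by
    rintro ⟨-, G, hG, hGU⟩
    obtain ⟨z, hz⟩ := mem_closure_iff.mp hx G hG.1.isOpen hG.2
    exact hGU hz

theorem isROFilter_compl_of_ideal {I : Order.Ideal (RegOpens X)} (hI : ⊤ ∉ I) :
    IsROFilter {U | ∃ a ∈ I, (aᶜ).set = U} where
  regular := by
    rintro _ ⟨a, -, rfl⟩
    exact RegOpens.isRegularOpen _
  univ_mem := ⟨⊥, I.bot_mem, by rw [compl_bot, RegOpens.set_top]⟩
  inter_mem := by
    rintro _ ⟨a, ha, rfl⟩ _ ⟨b, hb, rfl⟩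
    exact ⟨a ⊔ b, Order.Ideal.sup_mem ha hb, by rw [compl_sup]; rfl⟩
  mem_of_subset := by
    rintro _ ⟨a, ha, rfl⟩ V hV haV
    have hle : aᶜ ≤ RegOpens.mk V hV := haV
    exact ⟨(RegOpens.mk V hV)ᶜ, I.lower (compl_le_of_compl_le hle) ha,
      by rw [compl_compl, RegOpens.set_mk]⟩
  empty_notMem := by
    rintro ⟨a, ha, h⟩
    have htop : a = ⊤ := compl_eq_bot.mp (RegOpens.set_injective (h.trans RegOpens.set_bot.symm))
    exact hI (htop ▸ ha)

end RegularOpens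

namespace IsDVSpace

variable {X : Type u} [TopologicalSpace X] (hX : IsDVSpace X) {x y : X} {U V : Set X}
include hX

theorem subset_of_wayInside (hU : IsOpen U) (hV : IsRegularOpen V) (h : WayInside U V) :
    U ⊆ V := by
  rw [← hX.orderRegular V hV]
  exact subset_upInterior hU (subset_closure.trans h)

theorem exists_wayInside (hU : IsRegularOpen U) (hx : x ∈ U) :
    ∃ V, IsRegularOpen V ∧ x ∈ V ∧ WayInside V U := by
  have hmem : U ∈ regularNhds x := ⟨hU, hx⟩
  rw [← (hX.concordant x).roundPart_eq] at hmem
  obtain ⟨-, V, hV, hVU⟩ := hmem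
  exact ⟨V, hV.1, hV.2, hVU⟩

theorem specLE_of_regularNhds_subset (h : regularNhds x ⊆ regularNhds y) : SpecLE x y := by
  intro U hU hx
  obtain ⟨V, hV, hxV, hVU⟩ := hX.basis.exists_subset_of_mem_open hx hU
  exact hVU (h ⟨hV, hxV⟩).2

/-- The point is the limit of the filter generated by `U` and the regular open neighbourhoods
of `x`. -/
theorem exists_specLE_of_mem_closure (hU : IsRegularOpen U) (hx : x ∈ closure U) :
    ∃ y, SpecLE x y ∧ ∀ V, IsRegularOpen V → WayInside U V → y ∈ V := by
  have hF := isROFilter_of_mem_closure hx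
  obtain ⟨y, hy⟩ := hX.exists_point _ hF
  refine ⟨y, hX.specLE_of_regularNhds_subset ?_, fun V hV hUV => ?_⟩
  · rintro G ⟨hG, hxG⟩
    obtain ⟨H, hH, hxH, hHG⟩ := hX.exists_wayInside hG hxG
    rw [← hy]
    exact ⟨⟨hG, G, ⟨hG, hxG⟩, Set.inter_subset_left⟩,
      H, ⟨hH, H, ⟨hH, hxH⟩, Set.inter_subset_left⟩, hHG⟩
  · have huniv := (isROFilter_regularNhds x).univ_mem
    have hVy : V ∈ regularNhds y := by
      rw [← hy]
      exact ⟨⟨hV, _, huniv, Set.inter_subset_right.trans (hX.subset_of_wayInside hU.isOpen hV hUV)⟩,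
        U, ⟨hU, _, huniv, Set.inter_subset_right⟩, hUV⟩
    exact hVy.2

theorem wayInside_inter {W : Set X} (hU : IsRegularOpen U) (hV : IsRegularOpen V)
    (hW : IsRegularOpen W) (hUV : WayInside U V) (hUW : WayInside U W) : WayInside U (V ∩ W) := by
  intro x hx
  obtain ⟨y, hxy, hy⟩ := hX.exists_specLE_of_mem_closure hU hx
  exact ⟨y, ⟨hy V hV hUV, hy W hW hUW⟩, hxy⟩

theorem wayInside_perp (hV : IsRegularOpen V) (h : WayInside U V) :
    WayInside (perp V) (perp U) := by
  rw [WayInside, ← Set.compl_subset_compl, ← upInterior_compl, perp, perp, compl_compl, ← perp]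
  calc upInterior (closure U) ⊆ upInterior (down V) := upInterior_mono h
    _ = perp (perp V) := (hX.orderRegular V hV).trans hV.symm

theorem exists_wayInside_wayInside (hV : IsRegularOpen V) (h : WayInside U V) :
    ∃ W, IsRegularOpen W ∧ WayInside U W ∧ WayInside W V := by
  obtain ⟨P, Q, hP, hQ, hPQ, hUP, hVQ⟩ := hX.orderNormal (closure U) Vᶜ isClosed_closure
    hV.isRegularClosed_compl
    (by rwa [upInterior_compl, Set.disjoint_compl_right_iff_subset])
  rw [upInterior_compl] at hVQ
  refine ⟨interior (closure P), isRegularOpen_interior_closure P,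
    hUP.trans (down_mono hP.subset_interior_closure), ?_⟩
  calc closure (interior (closure P))
    _ ⊆ closure P := closure_minimal interior_subset isClosed_closure
    _ ⊆ Qᶜ := closure_minimal hPQ.subset_compl_right hQ.isClosed_compl
    _ ⊆ down V := Set.compl_subset_comm.mp hVQ

theorem isProximity : IsProximity (fun a b : RegOpens X => WayInside a.set b.set) where
  bot := by
    rw [WayInside, RegOpens.set_bot, closure_empty]
    exact Set.empty_subset _
  le {a b} h := RegOpens.set_subset_set.mp (hX.subset_of_wayInside a.isOpen b.isRegularOpen h)
  mono ha h hb := (closure_mono (RegOpens.set_subset_set.mpr ha)).trans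
    (h.trans (down_mono (RegOpens.set_subset_set.mpr hb)))
  inf {a b c} := hX.wayInside_inter a.isRegularOpen b.isRegularOpen c.isRegularOpen
  compl {a b} h := by
    rw [RegOpens.set_compl, RegOpens.set_compl]
    exact hX.wayInside_perp b.isRegularOpen h
  interpolate {a b} h := by
    obtain ⟨W, hW, haW, hWb⟩ := hX.exists_wayInside_wayInside b.isRegularOpen h
    exact ⟨.mk W hW, haW, hWb⟩

/-- The round ideal of the regular open sets whose closure does not contain a point. -/
def pointIdeal (x : X) : RoundIdeal hX.isProximity where
  toIdeal :=
    { carrier := {a | x ∈ (aᶜ).set}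
      lower' := fun _ _ h ha => RegOpens.set_subset_set.mpr (compl_le_compl h) ha
      nonempty' := ⟨⊥, by rw [Set.mem_ofPred_eq, compl_bot]; trivial⟩
      directed' := fun a ha b hb =>
        ⟨a ⊔ b, by rw [Set.mem_ofPred_eq, compl_sup]; exact ⟨ha, hb⟩, le_sup_left, le_sup_right⟩ }
  isRound a ha := by
    have hxa : x ∈ (aᶜ).set := ha
    obtain ⟨U, hU, hxU, hUa⟩ := hX.exists_wayInside (RegOpens.isRegularOpen _) hxa
    refine ⟨(RegOpens.mk U hU)ᶜ, show x ∈ ((RegOpens.mk U hU)ᶜᶜ).set by rwa [compl_compl], ?_⟩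
    simpa only [compl_compl] using hX.isProximity.compl (a := RegOpens.mk U hU) hUa

theorem mem_pointIdeal {a : RegOpens X} : a ∈ (hX.pointIdeal x).toIdeal ↔ x ∈ (aᶜ).set := Iff.rfl

theorem compl_mem_pointIdeal {a : RegOpens X} : aᶜ ∈ (hX.pointIdeal x).toIdeal ↔ x ∈ a.set := by
  rw [mem_pointIdeal, compl_compl]

theorem pointIdeal_ne_top (x : X) : hX.pointIdeal x ≠ ⊤ := by
  rw [Ne, ← RoundIdeal.top_mem_iff_eq_top, mem_pointIdeal, compl_top, RegOpens.set_bot]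
  exact Set.notMem_empty x

theorem specLE_of_pointIdeal_le (h : hX.pointIdeal x ≤ hX.pointIdeal y) : SpecLE x y :=
  hX.specLE_of_regularNhds_subset fun U ⟨hU, hxU⟩ =>
    have hmem (z : X) : (RegOpens.mk U hU)ᶜ ∈ (hX.pointIdeal z).toIdeal ↔ z ∈ U :=
      hX.compl_mem_pointIdeal
    ⟨hU, (hmem y).mp (h ((hmem x).mpr hxU))⟩

theorem exists_pointIdeal_eq {I : RoundIdeal hX.isProximity} (hI : I ≠ ⊤) :
    ∃ x, hX.pointIdeal x = I := by
  rw [Ne, ← RoundIdeal.top_mem_iff_eq_top] at hI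
  obtain ⟨x, hx⟩ := hX.exists_point _ (isROFilter_compl_of_ideal hI)
  refine ⟨x, RoundIdeal.ext (Order.Ideal.ext (Set.ext fun a => ?_))⟩
  rw [SetLike.mem_coe, SetLike.mem_coe, mem_pointIdeal]
  constructor
  · intro hxa
    have ha : (aᶜ).set ∈ regularNhds x := ⟨RegOpens.isRegularOpen _, hxa⟩
    rw [← hx] at ha
    obtain ⟨⟨b, hb, hba⟩, -⟩ := ha
    rwa [← compl_injective (RegOpens.set_injective hba)]
  · intro ha
    obtain ⟨b, hb, hab⟩ := I.isRound a ha
    have hxa : (aᶜ).set ∈ regularNhds x :=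
      hx ▸ ⟨⟨a, ha, rfl⟩, _, ⟨b, hb, rfl⟩, hX.isProximity.compl hab⟩
    exact hxa.2

/-- The points of a `dV`-space as points of `Ξ` of its frame of round ideals. -/
def toXi (x : X) : Xi (RoundIdeal hX.isProximity) := ⟨hX.pointIdeal x, hX.pointIdeal_ne_top x⟩

theorem toXi_bijective : Function.Bijective hX.toXi := by
  have := hX.t0
  refine ⟨fun x y h => ?_, fun ⟨I, hI⟩ => ?_⟩
  · have hxy : hX.pointIdeal x = hX.pointIdeal y := congrArg Subtype.val h
    exact (hX.specLE_of_pointIdeal_le hxy.le).antisymm (hX.specLE_of_pointIdeal_le hxy.ge)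
  · exact (hX.exists_pointIdeal_eq hI).imp fun _ => Subtype.ext

theorem preimage_toXi_cobasic (I : RoundIdeal hX.isProximity) :
    hX.toXi ⁻¹' cobasic I = ⋃ a ∈ I.toIdeal, a.set := by
  ext x
  simp only [Set.mem_iUnion, exists_prop, Set.mem_preimage, mem_cobasic, RoundIdeal.codisjoint_iff]
  refine exists_congr fun a => and_congr_right fun _ => ⟨fun ⟨b, hb, hab⟩ => ?_, fun hx => ?_⟩
  · exact RegOpens.set_subset_set.mpr (codisjoint_iff_compl_le_left.mp hab) hb
  · exact ⟨aᶜ, hX.compl_mem_pointIdeal.mpr hx, isCompl_compl.codisjoint⟩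

theorem preimage_toXi_cobasic_principal (a : RegOpens X) :
    hX.toXi ⁻¹' cobasic (.principal hX.isProximity a) = a.set := by
  rw [preimage_toXi_cobasic]
  refine Set.Subset.antisymm (Set.iUnion₂_subset fun b hb => ?_) fun x hx => ?_
  · exact hX.subset_of_wayInside b.isOpen a.isRegularOpen hb
  · obtain ⟨V, hV, hxV, hVa⟩ := hX.exists_wayInside a.isRegularOpen hx
    exact Set.mem_biUnion (show RegOpens.mk V hV ∈ _ from hVa) hxV

/-- A `dV`-space is homeomorphic to `Ξ` of its frame of round ideals. -/
noncomputable def toXiHomeomorph : X ≃ₜ Xi (RoundIdeal hX.isProximity) :=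
  (Equiv.ofBijective hX.toXi hX.toXi_bijective).toHomeomorphOfContinuousOpen
    (by
      refine (isTopologicalBasis_cobasic RoundIdeal.isCompactRegular).continuous_iff.mpr ?_
      rintro _ ⟨I, rfl⟩
      change IsOpen (hX.toXi ⁻¹' cobasic I)
      rw [preimage_toXi_cobasic]
      exact isOpen_biUnion fun a _ => a.isOpen)
    (by
      refine hX.basis.isOpenMap_iff.mpr fun U hU => ?_
      change IsOpen (hX.toXi '' U)
      rw [← RegOpens.set_mk U hU, ← preimage_toXi_cobasic_principal hX,
        Set.image_preimage_eq _ hX.toXi_bijective.surjective]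
      exact isOpen_cobasic RoundIdeal.isCompactRegular _)

end IsDVSpace

section Transport

theorem RatherBelow.map_orderIso {L M : Type u} [Order.Frame L] [Order.Frame M] {a b : L}
    (h : RatherBelow a b) (e : L ≃o M) : RatherBelow (e a) (e b) :=
  ratherBelow_of_disjoint_of_codisjoint (disjoint_compl_right.map_orderIso e)
    ((ratherBelow_iff_codisjoint.mp h).map_orderIso e)

theorem IsCompactRegular.of_orderIso {L M : Type u} [Order.Frame L] [Order.Frame M]
    (hL : IsCompactRegular L) (e : L ≃o M) : IsCompactRegular M where
  compact S hS := by
    classical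
    obtain ⟨T, hT, h⟩ := hL.compact (e.symm '' S) (by
      rw [sSup_image, ← e.symm.map_sSup, hS, e.symm.map_top])
    refine ⟨T.image e, ?_, ?_⟩
    · rw [Finset.coe_image, Set.image_subset_iff, e.preimage_eq_image_symm]
      exact hT
    · rw [Finset.coe_image, sSup_image, ← e.map_sSup, h, e.map_top]
  regular a := by
    refine le_antisymm ?_ (sSup_le fun b hb => RatherBelow.le hb)
    rw [← e.symm.le_iff_le, hL.regular (e.symm a)]
    refine sSup_le fun b hb => e.le_symm_apply.mpr (le_sSup ?_)
    have heb := RatherBelow.map_orderIso hb e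
    rwa [e.apply_symm_apply] at heb

theorem IsCompactRegular.isCompactRegularFrameOrder {L P : Type u} [Order.Frame L]
    [PartialOrder P] (hL : IsCompactRegular L) (e : L ≃o P) : IsCompactRegularFrameOrder P := by
  let _ : CompleteLattice P := e.toGaloisInsertion.liftCompleteLattice
  let F : Order.Frame P := Order.Frame.ofMinimalAxioms
    { inf_sSup_le_iSup_inf := fun a S => by
        rw [← e.symm.le_iff_le, e.symm.map_inf, e.symm.map_sSup, inf_iSup₂_eq]
        refine iSup₂_le fun b hb => ?_
        rw [← e.symm.map_inf, e.symm.le_iff_le]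
        exact le_iSup₂ (f := fun b (_ : b ∈ S) => a ⊓ b) b hb }
  exact ⟨F, fun _ _ => Iff.rfl, hL.of_orderIso e⟩

/-- Inverse image under a homeomorphism, as an isomorphism between the posets of well-rounded
order-regular open sets. -/
def woroCongr {X Y : Type u} [TopologicalSpace X] [TopologicalSpace Y] (e : X ≃ₜ Y) :
    WORO Y ≃o WORO X where
  toFun U := ⟨e ⁻¹' U.1, U.2.1.preimage e, U.2.2.preimage U.2.1.isOpen (isDVMap_homeomorph e)⟩
  invFun U := ⟨e.symm ⁻¹' U.1, U.2.1.preimage e.symm,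
    U.2.2.preimage U.2.1.isOpen (isDVMap_homeomorph e.symm)⟩
  left_inv U := Subtype.ext (e.toEquiv.symm_preimage_preimage U.1)
  right_inv U := Subtype.ext (e.toEquiv.preimage_symm_preimage U.1)
  map_rel_iff' := Set.preimage_subset_preimage_iff (by simp [e.surjective.range_eq])

end Transport

section Functors

namespace DVS

/-- The frame of round ideals of regular open subsets of a `dV`-space. -/
abbrev Ideals (X : DVS.{u}) : Type u := RoundIdeal X.isDVSpace.isProximity

/-- Round ideals of regular open sets correspond to well-rounded order-regular open sets. -/
noncomputable def idealsIso (X : DVS.{u}) : X.Ideals ≃o WORO X :=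
  (cobasicIso RoundIdeal.isCompactRegular).trans (woroCongr X.isDVSpace.toXiHomeomorph)

theorem coe_idealsIso (X : DVS.{u}) (I : X.Ideals) :
    (X.idealsIso I).1 = X.isDVSpace.toXiHomeomorph ⁻¹' cobasic I := rfl

theorem isCompactRegularFrameOrder_woro (X : DVS.{u}) : IsCompactRegularFrameOrder (WORO X) :=
  RoundIdeal.isCompactRegular.isCompactRegularFrameOrder X.idealsIso

theorem exists_frameHom_idealsIso {X Y : DVS.{u}} (f : X ⟶ Y) :
    ∃ h : FrameHom Y.Ideals X.Ideals,
      ∀ I, (X.idealsIso (h I)).1 = f.toFun ⁻¹' (Y.idealsIso I).1 := by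
  let eX := X.isDVSpace.toXiHomeomorph
  let eY := Y.isDVSpace.toXiHomeomorph
  obtain ⟨h, hh⟩ := exists_frameHom_preimage_cobasic RoundIdeal.isCompactRegular
    RoundIdeal.isCompactRegular
    ((isDVMap_homeomorph eY).comp (f.isDVMap.comp (isDVMap_homeomorph eX.symm)))
  refine ⟨h, fun I => ?_⟩
  rw [coe_idealsIso, coe_idealsIso, ← hh, ← Set.preimage_comp, ← Set.preimage_comp]
  exact congrArg (· ⁻¹' cobasic I)
    (funext fun x => congrArg (eY ∘ f.toFun) (eX.symm_apply_apply x))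

end DVS

theorem xiLifts : XiLifts.{u} where
  obj L := isDVSpace_xi L.property
  map {L M} h := isDVMap_xiMap L.property M.property (KRFrm.frameHom h)

/-- Conjugation of a frame homomorphism by order isomorphisms. -/
def frameHomConj {L M P Q : Type u} [Order.Frame L] [Order.Frame M] [Order.Frame P]
    [Order.Frame Q] (eP : L ≃o P) (eQ : M ≃o Q) (h : FrameHom L M) : FrameHom P Q :=
  ((eQ : FrameHom M Q).comp h).comp (eP.symm : FrameHom P L)

theorem woroLifts : WOROLifts.{u} where
  obj := DVS.isCompactRegularFrameOrder_woro
  map {X Y} f := by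
    obtain ⟨h, hh⟩ := DVS.exists_frameHom_idealsIso f
    let _ : Order.Frame (WORO X) := X.isCompactRegularFrameOrder_woro.frame
    let _ : Order.Frame (WORO Y) := Y.isCompactRegularFrameOrder_woro.frame
    refine ⟨ObjectProperty.homMk (Frm.ofHom (frameHomConj Y.idealsIso X.idealsIso h)),
      fun U => ?_⟩
    obtain ⟨I, rfl⟩ := Y.idealsIso.surjective U
    rw [← hh]
    exact congrArg (fun J => (X.idealsIso (h J)).1) (Y.idealsIso.symm_apply_apply I)

/-- Homeomorphic `dV`-spaces are isomorphic. -/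
def DVS.isoOfHomeomorph {X Y : DVS.{u}} (e : X ≃ₜ Y) : X ≅ Y where
  hom := ⟨e, isDVMap_homeomorph e⟩
  inv := ⟨e.symm, isDVMap_homeomorph e.symm⟩
  hom_inv_id := DVS.Hom.ext (funext e.symm_apply_apply)
  inv_hom_id := DVS.Hom.ext (funext e.apply_symm_apply)

/-- Isomorphic `dV`-spaces are homeomorphic. -/
def DVS.homeomorphOfIso {X Y : DVS.{u}} (e : X ≅ Y) : X ≃ₜ Y where
  toFun := e.hom.toFun
  invFun := e.inv.toFun
  left_inv := congrFun (congrArg DVS.Hom.toFun e.hom_inv_id)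
  right_inv := congrFun (congrArg DVS.Hom.toFun e.inv_hom_id)
  continuous_toFun := e.hom.isDVMap.continuous
  continuous_invFun := e.inv.isDVMap.continuous

instance faithful_xiFunctor (hΞ : XiLifts.{u}) : (xiFunctor hΞ).Faithful where
  map_injective H := Quiver.Hom.unop_inj <| ObjectProperty.hom_ext _ <|
    ConcreteCategory.hom_injective (xiMap_injective (congrArg DVS.Hom.toFun H))

instance full_xiFunctor (hΞ : XiLifts.{u}) : (xiFunctor hΞ).Full where
  map_surjective {L M} f := by
    obtain ⟨h, hh⟩ := exists_xiMap_eq M.unop.property L.unop.property f.isDVMap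
    exact ⟨(ObjectProperty.homMk (Frm.ofHom h)).op, DVS.Hom.ext hh⟩

instance essSurj_xiFunctor (hΞ : XiLifts.{u}) : (xiFunctor hΞ).EssSurj where
  mem_essImage X :=
    ⟨.op ⟨Frm.of X.Ideals, RoundIdeal.isCompactRegular⟩,
      ⟨DVS.isoOfHomeomorph X.isDVSpace.toXiHomeomorph.symm⟩⟩

instance essSurj_rightOp_xiFunctor (hΞ : XiLifts.{u}) : (xiFunctor hΞ).rightOp.EssSurj where
  mem_essImage X := by
    obtain ⟨L, ⟨e⟩⟩ := (essSurj_xiFunctor hΞ).mem_essImage X.unop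
    exact ⟨L.unop, ⟨e.symm.op⟩⟩

instance isEquivalence_rightOp_xiFunctor (hΞ : XiLifts.{u}) :
    (xiFunctor hΞ).rightOp.IsEquivalence := {}

/-- The natural isomorphism with components `cobasicIso` from compact regular frames to the frames
of well-rounded order-regular open sets of their spaces. -/
noncomputable def xiWoroIso (hΞ : XiLifts.{u}) (hW : WOROLifts.{u}) :
    𝟭 KRFrm.{u} ≅ (xiFunctor hΞ).rightOp ⋙ woroFunctor hW :=
  NatIso.ofComponents
    (fun L => ObjectProperty.isoMk _ (@Frm.Iso.mk L.obj
      (woroFrame hW.obj ⟨Xi L.obj, hΞ.obj L⟩).obj (cobasicIso L.property)))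
    (fun {L M} h => by
      apply ObjectProperty.hom_ext
      apply Frm.ext
      intro a
      apply Subtype.ext
      refine (preimage_xiMap_cobasic L.property M.property (KRFrm.frameHom h) a).symm.trans ?_
      exact ((hW.map ((xiFunctor hΞ).map h.op)).choose_spec (cobasicIso L.property a)).symm)

/-- The dual equivalence between `dV`-spaces and compact regular frames, with functor `𝒲` and
inverse `Ξ`. -/
noncomputable def dualEquivalence (hΞ : XiLifts.{u}) (hW : WOROLifts.{u}) :
    DVS.{u}ᵒᵖ ≌ KRFrm.{u} :=
  (xiFunctor hΞ).rightOp.asEquivalence.symm.changeFunctor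
    ((Functor.rightUnitor _).symm ≪≫
      Iso.inverseCompIso (G := (xiFunctor hΞ).rightOp.asEquivalence) (xiWoroIso hΞ hW))

end Functors

end DeVries

theorem theorem6p2 :
    ∃ (hΞ : DeVries.XiLifts.{u}) (hW : DeVries.WOROLifts.{u}),
      (∀ L : DeVries.KRFrm.{u}, Nonempty (L.obj ≃o DeVries.WORO (DeVries.Xi L.obj))) ∧
      (∀ X : DeVries.DVS.{u},
        Nonempty (X ≃ₜ DeVries.Xi (DeVries.woroFrame hW.obj X).obj)) ∧
      ∃ e : DeVries.DVS.{u}ᵒᵖ ≌ DeVries.KRFrm.{u},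
        e.functor = DeVries.woroFunctor hW ∧
          e.inverse = (DeVries.xiFunctor hΞ).rightOp := by
  refine ⟨DeVries.xiLifts, DeVries.woroLifts, fun L => ⟨DeVries.cobasicIso L.property⟩,
    fun X => ?_, DeVries.dualEquivalence DeVries.xiLifts DeVries.woroLifts, rfl, rfl⟩
  exact ⟨(DeVries.DVS.homeomorphOfIso
    ((DeVries.dualEquivalence DeVries.xiLifts DeVries.woroLifts).unitIso.app (.op X)).unop).symm⟩
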